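/- **Setting.** Let $\mathcal Z$ be a set, $d\ge 1$, and let $f=(f_1,\dots,f_d)$ be a centred Gaussian process on $\mathcal Z$ with values in $\mathbb R^d$ and matrix-valued covariance kernel $k$, i.e. $\operatorname{Cov}(f_r(z),f_s(z'))=[k(z,z')]_{rs}$. Let $z_1,\dots,z_n\in\mathcal Z$ be fixed, and observe $y_i=f(z_i)+\varepsilon_i$, where all coordinates of the $\varepsilon_i$ are i.i.d. $\mathcal N(0,\lambda^2)$, $\lambda>0$, independent of $f$. Let $\mathbf y_n\in\mathbb R^{nd}$ be the stacked observations, $\mathbf K_n\in\mathbb R^{nd\times nd}$ the block matrix with blocks $k(z_i,z_j)$, and $\mathbf k_n(z)\in\mathbb R^{nd\times d}$ the matrix with blocks $k(z_i,z)$. The posterior mean and covariance are $$\mu_n(z)=\mathbf k_n(z)^\top(\mathbf K_n+\lambda^2 I)^{-1}\mathbf y_n,\qquad \Sigma_n(z)=k(z,z)-\mathbf k_n(z)^\top(\mathbf K_n+\lambda^2 I)^{-1}\mathbf k_n(z),$$ and $\sigma_n(z)\in\mathbb R^d$ has entries $\sigma_{n,j}(z)=([\Sigma_n(z)]_{jj})^{1/2}$.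 For $\delta>0$ let $\beta_n(\delta)\in[0,\infty]$ be the scalar confidence multiplier: the infimum over $b\in[0,\infty)$ such that, for every coordinate $j$ separately, with probability at least $1-\delta$ the bound $|f_j(z)-\mu_{n,j}(z)|\le b\,\sigma_{n,j}(z)$ holds for all $z\in\mathcal Z$ (with $\beta_n(\delta)=\infty$ if there is no such $b$). Here and below, an event that may fail to be measurable is said to have probability at least $1-\delta$ if the outer measure of its complement is at most $\delta$. **Theorem.** 1. Let $\mathcal S\subseteq\mathbb R^d$ be a convex set (for instance $\mathcal S=\mathbb R^d$) in which $f(z)$ and $\mu_n(z)$ take their values for all $z\in\mathcal Z$, and let $v$ be a real function that is twice differentiable at every point of $\mathcal S$ (differentiable in a neighbourhood of the point in $\mathbb R^d$, with gradient differentiable at the point), with $\|\nabla v(s)\|\le u_G$ and $\|\nabla^2 v(s)\|_{\mathrm{op}}\le u_H$ for all $s\in\mathcal S$. Let $0<\delta<1$ and write $\beta=\beta_n(\delta/d)$; suppose $\beta<\infty$ (otherwise the bound below is void). Then, with probability at least $1-\delta$, for all $z\in\mathcal Z$, $$|v(f(z))-v(\mu_n(z))|\le u_G\,\beta\,\|\sigma_n(z)\|+\tfrac12\,u_H\,\beta^2\,\|\sigma_n(z)\|^2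 ,$$ where $\|\cdot\|$ is the Euclidean norm. 2. If $\mathcal Z$ is finite and nonempty, then $\beta_n(\delta)\le\sqrt{2\log(2|\mathcal Z|/\delta)}$ for all $0<\delta<1$; in particular, $\beta_n(\delta)$ is finite. -/

import Mathlib

open MeasureTheory ProbabilityTheory
open scoped ENNReal NNReal Matrix

noncomputable section

namespace MultiGP

/-- `f ~ GP(0, k)`: the `ℝᵈ`-valued process `f` is Gaussian under `P`, centred, and has the
matrix-valued covariance kernel `k`. -/
structure IsMultiOutputGP {Ω Z : Type*} [MeasurableSpace Ω] {d : ℕ} (P : Measure Ω)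
    (f : Z → Ω → EuclideanSpace ℝ (Fin d)) (k : Z → Z → Matrix (Fin d) (Fin d) ℝ) : Prop where
  isGaussianProcess : IsGaussianProcess f P
  mean_eq_zero : ∀ z r, ∫ ω, f z ω r ∂P = 0
  covariance_eq : ∀ z z' r s, cov[fun ω => f z ω r, fun ω => f z' ω s; P] = k z z' r s

/-- Observation noise: the coordinates of `ε₁, …, εₙ` are i.i.d. `N(0, lam²)`, and the noise is
independent of the process `f`. -/
structure IsGaussianNoise {Ω Z : Type*} [MeasurableSpace Ω] {d n : ℕ} (P : Measure Ω)
    (f : Z → Ω → EuclideanSpace ℝ (Fin d)) (lam : ℝ)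
    (ε : Fin n → Ω → EuclideanSpace ℝ (Fin d)) : Prop where
  hasLaw : ∀ i r, HasLaw (fun ω => ε i ω r) (gaussianReal 0 (Real.toNNReal (lam ^ 2))) P
  iIndepFun : iIndepFun (fun (p : Fin n × Fin d) ω => ε p.1 ω p.2) P
  indepFun : IndepFun (fun ω z => f z ω) (fun ω i => ε i ω) P

section Posterior

variable {Ω Z : Type*} {d n : ℕ}

/-- The stacked observations `yᵢ = f(zᵢ) + εᵢ`, as a vector of length `n d`. -/
def observations (f : Z → Ω → EuclideanSpace ℝ (Fin d)) (ε : Fin n → Ω → EuclideanSpace ℝ (Fin d))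
    (x : Fin n → Z) (ω : Ω) : Fin n × Fin d → ℝ :=
  fun p => f (x p.1) ω p.2 + ε p.1 ω p.2

/-- The block kernel matrix `Kₙ` of the design `x = (z₁, …, zₙ)`. -/
def gram (k : Z → Z → Matrix (Fin d) (Fin d) ℝ) (x : Fin n → Z) :
    Matrix (Fin n × Fin d) (Fin n × Fin d) ℝ :=
  Matrix.of fun p q => k (x p.1) (x q.1) p.2 q.2

/-- The cross-covariance `kₙ(z)` between the design and a test point `z`. -/
def cross (k : Z → Z → Matrix (Fin d) (Fin d) ℝ) (x : Fin n → Z) (z : Z) :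
    Matrix (Fin n × Fin d) (Fin d) ℝ :=
  Matrix.of fun p s => k (x p.1) z p.2 s

/-- Posterior mean `μₙ(z) = kₙ(z)ᵀ (Kₙ + lam² I)⁻¹ yₙ`. -/
def postMean (k : Z → Z → Matrix (Fin d) (Fin d) ℝ) (lam : ℝ)
    (f : Z → Ω → EuclideanSpace ℝ (Fin d)) (ε : Fin n → Ω → EuclideanSpace ℝ (Fin d))
    (x : Fin n → Z) (z : Z) (ω : Ω) : EuclideanSpace ℝ (Fin d) :=
  WithLp.toLp 2 (((cross k x z)ᵀ * (gram k x + lam ^ 2 • (1 : Matrix _ _ ℝ))⁻¹) *ᵥ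
    observations f ε x ω)

/-- Posterior covariance `Σₙ(z) = k(z, z) - kₙ(z)ᵀ (Kₙ + lam² I)⁻¹ kₙ(z)`. -/
def postCov (k : Z → Z → Matrix (Fin d) (Fin d) ℝ) (lam : ℝ) (x : Fin n → Z) (z : Z) :
    Matrix (Fin d) (Fin d) ℝ :=
  k z z - (cross k x z)ᵀ * (gram k x + lam ^ 2 • (1 : Matrix _ _ ℝ))⁻¹ * cross k x z

/-- The vector `σₙ(z)` of marginal posterior standard deviations. -/
def postStd (k : Z → Z → Matrix (Fin d) (Fin d) ℝ) (lam : ℝ) (x : Fin n → Z) (z : Z) :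
    EuclideanSpace ℝ (Fin d) :=
  WithLp.toLp 2 fun j => √(postCov k lam x z j j)

end Posterior

/-- The scalar confidence multiplier: the least `b ∈ [0, ∞]` such that, with probability at least
`1 - δ`, `|h(z) - m(z)| ≤ b s(z)` uniformly in `z`. The event need not be measurable when `Z` is
uncountable, so we bound the outer measure of its complement. -/
def scalarMultiplier {Ω Z : Type*} [MeasurableSpace Ω] (P : Measure Ω)
    (h m : Z → Ω → ℝ) (s : Z → ℝ) (δ : ℝ) : ℝ≥0∞ :=
  ⨅ (b : ℝ≥0) (_ : P {ω | ¬ ∀ z, |h z ω - m z ω| ≤ b * s z} ≤ ENNReal.ofReal δ), (b : ℝ≥0∞)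

/-- `βₙ(δ)`: the least multiplier for which the scalar confidence bound
`|fⱼ(z) - μₙⱼ(z)| ≤ βₙ(δ) σₙⱼ(z)`, uniformly in `z`, has probability at least `1 - δ` for each
output coordinate `j` separately. -/
def beta {Ω Z : Type*} [MeasurableSpace Ω] {d n : ℕ} (P : Measure Ω)
    (k : Z → Z → Matrix (Fin d) (Fin d) ℝ) (lam : ℝ)
    (f : Z → Ω → EuclideanSpace ℝ (Fin d)) (ε : Fin n → Ω → EuclideanSpace ℝ (Fin d))
    (x : Fin n → Z) (δ : ℝ) : ℝ≥0∞ :=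
  ⨆ j : Fin d, scalarMultiplier P (fun z ω => f z ω j) (fun z ω => postMean k lam f ε x z ω j)
    (fun z => postStd k lam x z j) δ

/-- `v` is twice differentiable at `s`: differentiable near `s`, with gradient differentiable
at `s`. -/
def TwiceDifferentiableAt {d : ℕ} (v : EuclideanSpace ℝ (Fin d) → ℝ)
    (s : EuclideanSpace ℝ (Fin d)) : Prop :=
  (∀ᶠ t in nhds s, DifferentiableAt ℝ v t) ∧ DifferentiableAt ℝ (gradient v) s

end MultiGP

end

/-! Bound 1 is deterministic on a good event. If every coordinate obeys its scalar bound with `β =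
βₙ(δ/d)`, then `‖f(z) - μₙ(z)‖ ≤ β‖σₙ(z)‖`, and a Taylor expansion at `μₙ(z)` finishes. The `d`
exceptional events cost `δ/d` each, because `β` itself, though an infimum, is an admissible
multiplier (`measure_exceed_le_of_scalarMultiplier_le`).

Bound 2 rests on `variance_coord_sub_postMean`: the residual `fⱼ(z) - μₙⱼ(z)` is a centred Gaussian
of variance exactly `[Σₙ(z)]ⱼⱼ`. Gaussian tails and a union bound over `Z` then suffice. -/

namespace MultiGP

/-! ### Deterministic Taylor bound and attainment of the infimum. -/

/-- Second-order Taylor bound along a segment in a convex set, for a function that is twice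
differentiable at each of its points. -/
theorem abs_sub_le_of_gradient_bounds {d : ℕ} {S : Set (EuclideanSpace ℝ (Fin d))}
    (hS : Convex ℝ S) {v : EuclideanSpace ℝ (Fin d) → ℝ} {u_G u_H : ℝ}
    (hv : ∀ s ∈ S, TwiceDifferentiableAt v s) (hG : ∀ s ∈ S, ‖gradient v s‖ ≤ u_G)
    (hH : ∀ s ∈ S, ‖fderiv ℝ (gradient v) s‖ ≤ u_H) {a b : EuclideanSpace ℝ (Fin d)}
    (ha : a ∈ S) (hb : b ∈ S) :
    |v b - v a| ≤ u_G * ‖b - a‖ + 1 / 2 * u_H * ‖b - a‖ ^ 2 := by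
  set h := b - a with hh
  have hmem : ∀ t ∈ Set.Icc (0 : ℝ) 1, a + t • h ∈ S := fun t ht =>
    hS.add_smul_sub_mem ha hb ht
  have hderiv : ∀ t ∈ Set.Icc (0 : ℝ) 1,
      HasDerivAt (fun t : ℝ => v (a + t • h) - v a - t * inner ℝ (gradient v a) h)
        (inner ℝ (gradient v (a + t • h) - gradient v a) h) t := by
    intro t ht
    have h1 : HasDerivAt (fun t : ℝ => a + t • h) h t := by
      simpa using ((hasDerivAt_id t).smul_const h).const_add a
    have h2 := (hv _ (hmem t ht)).1.self_of_nhds.hasGradientAt.hasFDerivAt.comp_hasDerivAt t h1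
    have h3 := (h2.sub_const (v a)).sub ((hasDerivAt_id t).mul_const (inner ℝ (gradient v a) h))
    convert! h3 using 1
    simp [inner_sub_left]
  have hB : ∀ t : ℝ, HasDerivAt (fun t : ℝ => u_H * ‖h‖ ^ 2 * t ^ 2 / 2) (u_H * ‖h‖ ^ 2 * t) t := by
    intro t
    convert! (((hasDerivAt_id t).pow 2).const_mul (u_H * ‖h‖ ^ 2)).div_const 2 using 1
    simp; ring
  -- Comparing derivatives instead of integrating a remainder: the Hessian is not assumed
  -- continuous.
  have key := image_norm_le_of_norm_deriv_right_le_deriv_boundary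
    (f := fun t : ℝ => v (a + t • h) - v a - t * inner ℝ (gradient v a) h)
    (fun t ht => (hderiv t ht).continuousAt.continuousWithinAt)
    (fun t ht => (hderiv t (Set.Ico_subset_Icc_self ht)).hasDerivWithinAt)
    (by simp) hB ?_ (Set.right_mem_Icc.2 zero_le_one)
  · have h0 : |v b - v a - inner ℝ (gradient v a) h| ≤ u_H * ‖h‖ ^ 2 / 2 := by
      simpa [hh] using key
    have h1 : |inner ℝ (gradient v a) h| ≤ u_G * ‖h‖ :=
      (abs_real_inner_le_norm _ _).trans (by gcongr; exact hG a ha)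
    calc |v b - v a| = |(v b - v a - inner ℝ (gradient v a) h) + inner ℝ (gradient v a) h| := by
          rw [sub_add_cancel]
      _ ≤ _ := abs_add_le _ _
      _ ≤ _ := by linarith
  · intro t ht
    -- By convexity the Hessian bound makes the gradient `u_H`-Lipschitz on `S`.
    have hlip := hS.norm_image_sub_le_of_norm_fderiv_le (fun s hs => (hv s hs).2) hH ha
      (hmem t (Set.Ico_subset_Icc_self ht))
    rw [add_sub_cancel_left, norm_smul, Real.norm_of_nonneg ht.1] at hlip
    calc ‖inner ℝ (gradient v (a + t • h) - gradient v a) h‖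
        ≤ ‖gradient v (a + t • h) - gradient v a‖ * ‖h‖ := norm_inner_le_norm _ _
      _ ≤ u_H * (t * ‖h‖) * ‖h‖ := by gcongr
      _ = u_H * ‖h‖ ^ 2 * t := by ring

/-- The infimum in the definition of the scalar multiplier is attained. -/
theorem measure_exceed_le_of_scalarMultiplier_le {Ω Z : Type*} [MeasurableSpace Ω] {P : Measure Ω}
    {h m : Z → Ω → ℝ} {s : Z → ℝ} (hs : ∀ z, 0 ≤ s z) {δ : ℝ} {b : ℝ≥0}
    (hb : scalarMultiplier P h m s δ ≤ b) :
    P {ω | ¬ ∀ z, |h z ω - m z ω| ≤ b * s z} ≤ ENNReal.ofReal δ := by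
  -- Each `b + 1/(i+1)` strictly exceeds the infimum, so it dominates an admissible multiplier.
  have hstep : ∀ i : ℕ, P {ω | ¬ ∀ z, |h z ω - m z ω| ≤ ((b : ℝ) + 1 / ((i : ℝ) + 1)) * s z} ≤
      ENNReal.ofReal δ := by
    intro i
    have hlt : scalarMultiplier P h m s δ < ((b + 1 / ((i : ℝ≥0) + 1) : ℝ≥0) : ℝ≥0∞) :=
      hb.trans_lt (ENNReal.coe_lt_coe.2 (lt_add_of_pos_right _ (by positivity)))
    obtain ⟨c, hc⟩ := iInf_lt_iff.1 hlt
    obtain ⟨hcP, hc⟩ := iInf_lt_iff.1 hc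
    refine le_trans (measure_mono ?_) hcP
    intro ω hω hall
    refine hω fun z => (hall z).trans ?_
    have hc' : (c : ℝ) ≤ b + 1 / ((i : ℝ) + 1) := by
      have := ENNReal.coe_lt_coe.1 hc
      exact_mod_cast this.le
    exact mul_le_mul_of_nonneg_right hc' (hs z)
  have hmono : Monotone fun i : ℕ =>
      {ω | ¬ ∀ z, |h z ω - m z ω| ≤ ((b : ℝ) + 1 / ((i : ℝ) + 1)) * s z} := by
    intro i j hij ω hω hall
    refine hω fun z => (hall z).trans (mul_le_mul_of_nonneg_right ?_ (hs z))
    gcongr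
  calc P {ω | ¬ ∀ z, |h z ω - m z ω| ≤ b * s z}
      ≤ P (⋃ i : ℕ, {ω | ¬ ∀ z, |h z ω - m z ω| ≤ ((b : ℝ) + 1 / ((i : ℝ) + 1)) * s z}) := by
        refine measure_mono fun ω hω => ?_
        by_contra hcon
        simp only [Set.mem_iUnion, Set.mem_ofPred_eq, not_exists, not_not] at hcon
        refine hω fun z => ?_
        have hlim : Filter.Tendsto (fun i : ℕ => ((b : ℝ) + 1 / ((i : ℝ) + 1)) * s z)
            Filter.atTop (nhds (((b : ℝ) + 0) * s z)) :=
          (tendsto_const_nhds.add tendsto_one_div_add_atTop_nhds_zero_nat).mul_const _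
        simpa using ge_of_tendsto' hlim fun i => hcon i z
    -- Continuity from below holds for outer measure too, so measurability plays no role.
    _ = ⨆ i : ℕ, P {ω | ¬ ∀ z, |h z ω - m z ω| ≤ ((b : ℝ) + 1 / ((i : ℝ) + 1)) * s z} :=
        hmono.measure_iUnion
    _ ≤ ENNReal.ofReal δ := iSup_le hstep

theorem norm_le_mul_norm_of_abs_le {d : ℕ} {a s : EuclideanSpace ℝ (Fin d)} {b : ℝ}
    (hb : 0 ≤ b) (h : ∀ j, |a j| ≤ b * s j) : ‖a‖ ≤ b * ‖s‖ := by
  refine le_of_sq_le_sq ?_ (by positivity)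
  rw [mul_pow, EuclideanSpace.real_norm_sq_eq, EuclideanSpace.real_norm_sq_eq, Finset.mul_sum]
  refine Finset.sum_le_sum fun j _ => ?_
  rw [← mul_pow, ← sq_abs]
  exact pow_le_pow_left₀ (abs_nonneg _) (h j) 2

end MultiGP
namespace MultiGP

/-! ### Gaussian tails. -/

/-- Two-sided Gaussian tail bound, including the degenerate case of variance zero. -/
theorem measure_abs_gt_le_of_hasGaussianLaw {Ω : Type*} [MeasurableSpace Ω] {P : Measure Ω}
    {X : Ω → ℝ} (hX : HasGaussianLaw X P) (hmean : ∫ ω, X ω ∂P = 0) {b : ℝ} (hb : 0 ≤ b) :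
    P {ω | ¬ |X ω| ≤ b * √Var[X; P]} ≤ ENNReal.ofReal (2 * Real.exp (-b ^ 2 / 2)) := by
  have := hX.isProbabilityMeasure
  have hV : 0 ≤ Var[X; P] := variance_nonneg X P
  -- Variance zero is split off because the exponent in `hexp` would then be a division by zero,
  -- with value `0`.
  rcases hV.eq_or_lt with hV0 | hVpos
  · have hae : ∀ᵐ ω ∂P, X ω = 0 := by
      simpa [hmean] using ae_eq_integral_of_variance_eq_zero hX.memLp_two hV0.symm
    refine le_of_eq_of_le ?_ zero_le
    refine measure_mono_null (fun ω hω => ?_) (ae_iff.1 hae)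
    intro h0
    exact hω (by simp [h0, ← hV0])
  have hmap : P.map X = gaussianReal 0 Var[X; P].toNNReal := by
    rw [hX.map_eq_gaussianReal, hmean]
  have hsub : HasSubgaussianMGF X Var[X; P].toNNReal P := by
    refine ⟨fun t => ?_, fun t => ?_⟩
    · have := integrable_exp_mul_gaussianReal (μ := 0) (v := Var[X; P].toNNReal) t
      rw [← hmap] at this
      exact this.comp_aemeasurable hX.aemeasurable
    · rw [mgf_gaussianReal hmap, zero_mul, zero_add]
  have hexp : -(b * √Var[X; P]) ^ 2 / (2 * (Var[X; P].toNNReal : ℝ)) = -b ^ 2 / 2 := by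
    rw [mul_pow, Real.sq_sqrt hV, Real.coe_toNNReal _ hV]
    field_simp
  have hpos : 0 ≤ b * √Var[X; P] := by positivity
  have h1 := hsub.measure_ge_le hpos
  have h2 := hsub.neg.measure_ge_le hpos
  rw [hexp] at h1 h2
  have hreal : P.real {ω | ¬ |X ω| ≤ b * √Var[X; P]} ≤ 2 * Real.exp (-b ^ 2 / 2) := by
    calc P.real {ω | ¬ |X ω| ≤ b * √Var[X; P]}
        ≤ P.real ({ω | b * √Var[X; P] ≤ X ω} ∪ {ω | b * √Var[X; P] ≤ (-X) ω}) := by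
          refine measureReal_mono fun ω hω => ?_
          rcases lt_abs.1 (not_le.1 hω) with h | h
          · exact Or.inl h.le
          · exact Or.inr h.le
      _ ≤ _ := measureReal_union_le _ _
      _ ≤ _ := by linarith
  rw [← ofReal_measureReal]
  exact ENNReal.ofReal_le_ofReal hreal

/-! ### Law of the posterior residual. -/

section Posterior

variable {Ω Z : Type*} [MeasurableSpace Ω] {P : Measure Ω} {d n : ℕ}
  {k : Z → Z → Matrix (Fin d) (Fin d) ℝ} {f : Z → Ω → EuclideanSpace ℝ (Fin d)}

theorem IsMultiOutputGP.isGaussianProcess_coord (hf : IsMultiOutputGP P f k) :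
    IsGaussianProcess (fun (p : Z × Fin d) ω => f p.1 ω p.2) P :=
  (hf.isGaussianProcess.comp_right Prod.fst).comp_left
    (fun p : Z × Fin d => EuclideanSpace.proj p.2)

theorem IsMultiOutputGP.memLp_coord (hf : IsMultiOutputGP P f k) (z : Z) (r : Fin d) :
    MemLp (fun ω => f z ω r) 2 P :=
  (hf.isGaussianProcess_coord.hasGaussianLaw_eval (z, r)).memLp_two

theorem IsMultiOutputGP.kernel_symm (hf : IsMultiOutputGP P f k) (z z' : Z) (r s : Fin d) :
    k z z' r s = k z' z s r := by
  rw [← hf.covariance_eq, ← hf.covariance_eq, covariance_comm]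

theorem IsMultiOutputGP.hasGaussianLaw_linearCombination (hf : IsMultiOutputGP P f k)
    {ι : Type*} [Fintype ι] (t : ι → Z × Fin d) (c : ι → ℝ) :
    HasGaussianLaw (fun ω => ∑ i, c i * f (t i).1 ω (t i).2) P :=
  ((hf.isGaussianProcess_coord.comp_right t).smul c).hasGaussianLaw_fun_sum (I := Finset.univ)

theorem IsMultiOutputGP.integral_linearCombination (hf : IsMultiOutputGP P f k)
    [IsProbabilityMeasure P] {ι : Type*} [Fintype ι] (t : ι → Z × Fin d) (c : ι → ℝ) :
    ∫ ω, ∑ i, c i * f (t i).1 ω (t i).2 ∂P = 0 := by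
  rw [integral_finsetSum _ fun i _ =>
    ((hf.memLp_coord (t i).1 (t i).2).integrable one_le_two).const_mul _]
  simp [integral_const_mul, hf.mean_eq_zero]

theorem IsMultiOutputGP.variance_linearCombination (hf : IsMultiOutputGP P f k)
    [IsProbabilityMeasure P] {ι : Type*} [Fintype ι] (t : ι → Z × Fin d) (c : ι → ℝ) :
    Var[fun ω => ∑ i, c i * f (t i).1 ω (t i).2; P] =
      ∑ i, ∑ j, c i * c j * k (t i).1 (t j).1 (t i).2 (t j).2 := by
  rw [variance_fun_sum fun i => (hf.memLp_coord (t i).1 (t i).2).const_mul (c i)]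
  refine Finset.sum_congr rfl fun i _ => Finset.sum_congr rfl fun j _ => ?_
  rw [covariance_const_mul_left, covariance_const_mul_right, hf.covariance_eq, mul_assoc]

/-- The quadratic form at `u` is the variance of `∑ u p * f (x p.1) p.2`. -/
theorem IsMultiOutputGP.posSemidef_gram (hf : IsMultiOutputGP P f k) [IsProbabilityMeasure P]
    (x : Fin n → Z) : (gram k x).PosSemidef := by
  refine Matrix.PosSemidef.of_dotProduct_mulVec_nonneg ?_ fun u => ?_
  · ext p q
    exact hf.kernel_symm _ _ _ _
  · have h := variance_nonneg (fun ω => ∑ p : Fin n × Fin d, u p * f (x p.1) ω p.2) P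
    rw [hf.variance_linearCombination (fun p : Fin n × Fin d => (x p.1, p.2)) u] at h
    refine h.trans_eq ?_
    simp only [dotProduct, Matrix.mulVec, Finset.mul_sum, gram, Matrix.of_apply, star_trivial]
    exact Finset.sum_congr rfl fun i _ => Finset.sum_congr rfl fun j _ => by ring

/-- Positive definite plus positive semidefinite; hence `⁻¹` in the posterior is a genuine inverse,
not the default `0`. -/
theorem IsMultiOutputGP.isUnit_det_gram_add (hf : IsMultiOutputGP P f k) [IsProbabilityMeasure P]
    (x : Fin n → Z) {lam : ℝ} (hlam : 0 < lam) :
    IsUnit (gram k x + lam ^ 2 • (1 : Matrix (Fin n × Fin d) (Fin n × Fin d) ℝ)).det := by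
  rw [← Matrix.isUnit_iff_isUnit_det]
  exact ((Matrix.PosDef.one.smul (by positivity : 0 < lam ^ 2)).posSemidef_add
    (hf.posSemidef_gram x)).isUnit

variable {lam : ℝ} {ε : Fin n → Ω → EuclideanSpace ℝ (Fin d)}

theorem IsGaussianNoise.hasGaussianLaw_coord (hε : IsGaussianNoise P f lam ε) (i : Fin n)
    (r : Fin d) : HasGaussianLaw (fun ω => ε i ω r) P :=
  (hε.hasLaw i r).hasGaussianLaw

theorem IsGaussianNoise.iIndepFun_const_mul (hε : IsGaussianNoise P f lam ε)
    (c : Fin n × Fin d → ℝ) :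
    ProbabilityTheory.iIndepFun (fun (p : Fin n × Fin d) ω => c p * ε p.1 ω p.2) P :=
  hε.iIndepFun.comp (fun p y => c p * y) fun p => measurable_const_mul (c p)

theorem IsGaussianNoise.hasGaussianLaw_linearCombination (hε : IsGaussianNoise P f lam ε)
    (c : Fin n × Fin d → ℝ) : HasGaussianLaw (fun ω => ∑ p, c p * ε p.1 ω p.2) P :=
  iIndepFun.hasGaussianLaw_fun_sum
    (fun p => (hε.hasGaussianLaw_coord p.1 p.2).fun_smul (c p)) (hε.iIndepFun_const_mul c)

theorem IsGaussianNoise.integral_linearCombination (hε : IsGaussianNoise P f lam ε)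
    (c : Fin n × Fin d → ℝ) : ∫ ω, ∑ p, c p * ε p.1 ω p.2 ∂P = 0 := by
  rw [integral_finsetSum _ fun p _ => (hε.hasGaussianLaw_coord p.1 p.2).integrable.const_mul _]
  refine Finset.sum_eq_zero fun p _ => ?_
  rw [integral_const_mul, (hε.hasLaw p.1 p.2).integral_eq, integral_id_gaussianReal, mul_zero]

theorem IsGaussianNoise.variance_linearCombination (hε : IsGaussianNoise P f lam ε)
    (c : Fin n × Fin d → ℝ) :
    Var[fun ω => ∑ p, c p * ε p.1 ω p.2; P] = lam ^ 2 * ∑ p, c p ^ 2 := by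
  have h := IndepFun.variance_sum (s := Finset.univ)
    (X := fun (p : Fin n × Fin d) ω => c p * ε p.1 ω p.2) (μ := P)
    (fun p _ => (hε.hasGaussianLaw_coord p.1 p.2).memLp_two.const_mul (c p))
    (fun p _ q _ hpq => (hε.iIndepFun_const_mul c).indepFun hpq)
  rw [Finset.sum_fn] at h
  rw [h, Finset.mul_sum]
  refine Finset.sum_congr rfl fun p _ => ?_
  rw [variance_const_mul, (hε.hasLaw p.1 p.2).variance_eq, variance_id_gaussianReal,
    Real.coe_toNNReal _ (sq_nonneg lam), mul_comm]

/-- The row of `kₙ(z)ᵀ (Kₙ + lam² I)⁻¹` that yields coordinate `j` of the posterior mean. -/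
noncomputable def postWeight (k : Z → Z → Matrix (Fin d) (Fin d) ℝ) (lam : ℝ) (x : Fin n → Z) (z : Z)
    (j : Fin d) : Fin n × Fin d → ℝ :=
  ((cross k x z)ᵀ * (gram k x + lam ^ 2 • (1 : Matrix _ _ ℝ))⁻¹ :
    Matrix (Fin d) (Fin n × Fin d) ℝ) j

theorem postMean_apply {Ω : Type*} {f : Z → Ω → EuclideanSpace ℝ (Fin d)}
    {ε : Fin n → Ω → EuclideanSpace ℝ (Fin d)} (x : Fin n → Z) (z : Z) (ω : Ω) (j : Fin d) :
    postMean k lam f ε x z ω j =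
      ∑ p, postWeight k lam x z j p * (f (x p.1) ω p.2 + ε p.1 ω p.2) :=
  rfl

theorem postCov_apply (x : Fin n → Z) (z : Z) (j : Fin d) :
    postCov k lam x z j j = k z z j j - ∑ p, postWeight k lam x z j p * k (x p.1) z p.2 j :=
  rfl

/-- The weights solve the linear system of kernel ridge regression. The variance computation needs
no other fact about the inverse. -/
theorem IsMultiOutputGP.postWeight_normal_eq (hf : IsMultiOutputGP P f k) [IsProbabilityMeasure P]
    (x : Fin n → Z) (hlam : 0 < lam) (z : Z) (j : Fin d) (q : Fin n × Fin d) :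
    ∑ p, postWeight k lam x z j p * k (x p.1) (x q.1) p.2 q.2 + lam ^ 2 * postWeight k lam x z j q =
      k (x q.1) z q.2 j := by
  have h : (cross k x z)ᵀ * (gram k x + lam ^ 2 • (1 : Matrix _ _ ℝ))⁻¹ *
      (gram k x + lam ^ 2 • (1 : Matrix _ _ ℝ)) = (cross k x z)ᵀ :=
    Matrix.nonsing_inv_mul_cancel_right _ _ (hf.isUnit_det_gram_add x hlam)
  rw [Matrix.mul_add, Matrix.mul_smul, Matrix.mul_one] at h
  exact congrFun (congrFun h j) q

/-- The residual of coordinate `j` at `z` as a linear combination of process values minus one of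
the noise. -/
theorem coord_sub_postMean {Ω : Type*} {f : Z → Ω → EuclideanSpace ℝ (Fin d)}
    {ε : Fin n → Ω → EuclideanSpace ℝ (Fin d)} (x : Fin n → Z) (z : Z) (j : Fin d) (ω : Ω) :
    f z ω j - postMean k lam f ε x z ω j =
      (∑ i : Option (Fin n × Fin d), (i.elim 1 fun p => -postWeight k lam x z j p) *
        f (i.elim (z, j) fun p => (x p.1, p.2)).1 ω (i.elim (z, j) fun p => (x p.1, p.2)).2) -
      ∑ p, postWeight k lam x z j p * ε p.1 ω p.2 := by
  -- `none` is the test coordinate `(z, j)` with coefficient `1`; `some p` is a design coordinate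
  -- with its weight negated.
  rw [Fintype.sum_option, postMean_apply]
  simp only [Option.elim_none, Option.elim_some, mul_add, Finset.sum_add_distrib, neg_mul,
    Finset.sum_neg_distrib]
  ring

theorem IsGaussianNoise.indepFun_linearCombination (hε : IsGaussianNoise P f lam ε)
    {ι : Type*} [Fintype ι] (t : ι → Z × Fin d) (c : ι → ℝ) (w : Fin n × Fin d → ℝ) :
    IndepFun (fun ω => ∑ i, c i * f (t i).1 ω (t i).2) (fun ω => ∑ p, w p * ε p.1 ω p.2) P :=
  hε.indepFun.comp (φ := fun g : Z → EuclideanSpace ℝ (Fin d) => ∑ i, c i * g (t i).1 (t i).2)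
    (ψ := fun e : Fin n → EuclideanSpace ℝ (Fin d) => ∑ p, w p * e p.1 p.2)
    (by fun_prop) (by fun_prop)

theorem hasGaussianLaw_coord_sub_postMean (hf : IsMultiOutputGP P f k)
    (hε : IsGaussianNoise P f lam ε) (x : Fin n → Z) (z : Z) (j : Fin d) :
    HasGaussianLaw (fun ω => f z ω j - postMean k lam f ε x z ω j) P := by
  simp_rw [coord_sub_postMean]
  exact iIndepFun.hasGaussianLaw_fun_sub (hf.hasGaussianLaw_linearCombination _ _)
    (hε.hasGaussianLaw_linearCombination _) (hε.indepFun_linearCombination _ _ _)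

theorem integral_coord_sub_postMean [IsProbabilityMeasure P] (hf : IsMultiOutputGP P f k)
    (hε : IsGaussianNoise P f lam ε) (x : Fin n → Z) (z : Z) (j : Fin d) :
    ∫ ω, f z ω j - postMean k lam f ε x z ω j ∂P = 0 := by
  simp_rw [coord_sub_postMean]
  rw [integral_sub (hf.hasGaussianLaw_linearCombination _ _).integrable
    (hε.hasGaussianLaw_linearCombination _).integrable, hf.integral_linearCombination,
    hε.integral_linearCombination, sub_zero]

/-- The residual variance is the diagonal entry of the posterior covariance. -/
theorem variance_coord_sub_postMean [IsProbabilityMeasure P] (hf : IsMultiOutputGP P f k)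
    (hε : IsGaussianNoise P f lam ε) (hlam : 0 < lam) (x : Fin n → Z) (z : Z) (j : Fin d) :
    Var[fun ω => f z ω j - postMean k lam f ε x z ω j; P] = postCov k lam x z j j := by
  simp_rw [coord_sub_postMean]
  have hF := hf.hasGaussianLaw_linearCombination
    (fun i : Option (Fin n × Fin d) => i.elim (z, j) fun p => (x p.1, p.2))
    (fun i => i.elim 1 fun p => -postWeight k lam x z j p)
  have hE := hε.hasGaussianLaw_linearCombination (postWeight k lam x z j)
  rw [variance_fun_sub hF.memLp_two hE.memLp_two,
    (hε.indepFun_linearCombination _ _ _).covariance_eq_zero hF.memLp_two hE.memLp_two,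
    hf.variance_linearCombination, hε.variance_linearCombination, postCov_apply]
  simp only [Fintype.sum_option, Option.elim_none, Option.elim_some]
  -- With `w` the weights and `c` the cross-covariance column, the normal equations give `wᵀ(Kₙ +
  -- lam² I)w = wᵀc`. So the variance `k(z,z)ⱼⱼ - 2wᵀc + wᵀ(Kₙ + lam² I)w` collapses to `k(z,z)ⱼⱼ -
  -- wᵀc`.
  have hquad : ∑ p, ∑ q, postWeight k lam x z j p * postWeight k lam x z j q *
      k (x p.1) (x q.1) p.2 q.2 + lam ^ 2 * ∑ q, postWeight k lam x z j q ^ 2 =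
      ∑ q, postWeight k lam x z j q * k (x q.1) z q.2 j := by
    rw [Finset.sum_comm, Finset.mul_sum, ← Finset.sum_add_distrib]
    refine Finset.sum_congr rfl fun q _ => ?_
    rw [← hf.postWeight_normal_eq x hlam z j q, mul_add, Finset.mul_sum]
    congr 1
    · exact Finset.sum_congr rfl fun p _ => by ring
    · ring
  have hsymm : ∀ p : Fin n × Fin d, k z (x p.1) j p.2 = k (x p.1) z p.2 j := fun p =>
    hf.kernel_symm _ _ _ _
  simp only [hsymm, mul_one, one_mul, neg_mul, mul_neg, neg_neg, Finset.sum_neg_distrib,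
    Finset.sum_add_distrib]
  linarith

/-- Over a finite index set, a union bound over Gaussian tails controls the multiplier. -/
theorem beta_le_of_finite [IsProbabilityMeasure P] [Finite Z] (hf : IsMultiOutputGP P f k)
    (hε : IsGaussianNoise P f lam ε) (hlam : 0 < lam) (x : Fin n → Z) {δ : ℝ} (hδ : 0 < δ)
    (hδ1 : δ < 1) :
    beta P k lam f ε x δ ≤ ENNReal.ofReal √(2 * Real.log (2 * Nat.card Z / δ)) := by
  refine iSup_le fun j => ?_
  refine iInf₂_le_of_le (Real.toNNReal √(2 * Real.log (2 * Nat.card Z / δ))) ?_ le_rfl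
  rw [Real.coe_toNNReal _ (Real.sqrt_nonneg _)]
  have := Fintype.ofFinite Z
  rcases isEmpty_or_nonempty Z with hZ | hZ
  -- The exceptional event is empty here.
  · simp
  have hcard : (1 : ℝ) ≤ Nat.card Z := by exact_mod_cast Nat.card_pos
  have hlog : 0 ≤ 2 * Real.log (2 * Nat.card Z / δ) := by
    refine mul_nonneg zero_le_two (Real.log_nonneg ?_)
    rw [le_div_iff₀ hδ]
    linarith
  -- The multiplier is chosen so that each point costs exactly `δ / |Z|`.
  have htail : 2 * Real.exp (-√(2 * Real.log (2 * Nat.card Z / δ)) ^ 2 / 2) = δ / Nat.card Z := by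
    rw [Real.sq_sqrt hlog, show -(2 * Real.log (2 * Nat.card Z / δ)) / 2 =
      -Real.log (2 * Nat.card Z / δ) by ring, Real.exp_neg, Real.exp_log (by positivity)]
    field_simp
  calc P {ω | ¬ ∀ z, |f z ω j - postMean k lam f ε x z ω j| ≤
        √(2 * Real.log (2 * Nat.card Z / δ)) * postStd k lam x z j}
      ≤ P (⋃ z, {ω | ¬ |f z ω j - postMean k lam f ε x z ω j| ≤
        √(2 * Real.log (2 * Nat.card Z / δ)) * postStd k lam x z j}) := by
        refine measure_mono fun ω hω => ?_
        simpa using hω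
    _ ≤ ∑ z, P {ω | ¬ |f z ω j - postMean k lam f ε x z ω j| ≤
        √(2 * Real.log (2 * Nat.card Z / δ)) * postStd k lam x z j} :=
        measure_iUnion_fintype_le _ _
    _ ≤ ∑ _z : Z, ENNReal.ofReal (δ / Nat.card Z) := by
        refine Finset.sum_le_sum fun z _ => ?_
        have h := measure_abs_gt_le_of_hasGaussianLaw (hasGaussianLaw_coord_sub_postMean hf hε x z j)
          (integral_coord_sub_postMean hf hε x z j)
          (Real.sqrt_nonneg (2 * Real.log (2 * Nat.card Z / δ)))
        rwa [htail, variance_coord_sub_postMean hf hε hlam x z j] at h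
    _ = ENNReal.ofReal δ := by
        rw [← ENNReal.ofReal_sum_of_nonneg fun _ _ => by positivity]
        congr 1
        rw [Finset.sum_const, Finset.card_univ, nsmul_eq_mul, Nat.card_eq_fintype_card]
        have : (Fintype.card Z : ℝ) ≠ 0 := by positivity
        field_simp

end Posterior

/-! ### Union bound over coordinates and conclusion. -/

/-- With probability at least `1 - δ`, every coordinate obeys its confidence bound at level
`δ / d`. -/
theorem measure_exists_coord_exceed_le {Ω Z : Type*} [MeasurableSpace Ω] {P : Measure Ω}
    {d n : ℕ} (hd : 0 < d) {k : Z → Z → Matrix (Fin d) (Fin d) ℝ}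
    {f : Z → Ω → EuclideanSpace ℝ (Fin d)} {lam : ℝ} {ε : Fin n → Ω → EuclideanSpace ℝ (Fin d)}
    {x : Fin n → Z} {δ : ℝ} (hδ : 0 < δ) (hβ : beta P k lam f ε x (δ / d) ≠ ⊤) :
    P (⋃ j, {ω | ¬ ∀ z, |f z ω j - postMean k lam f ε x z ω j| ≤
      (beta P k lam f ε x (δ / d)).toReal * postStd k lam x z j}) ≤ ENNReal.ofReal δ := by
  calc P (⋃ j, {ω | ¬ ∀ z, |f z ω j - postMean k lam f ε x z ω j| ≤
        (beta P k lam f ε x (δ / d)).toReal * postStd k lam x z j})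
      ≤ ∑ j, P {ω | ¬ ∀ z, |f z ω j - postMean k lam f ε x z ω j| ≤
        (beta P k lam f ε x (δ / d)).toReal * postStd k lam x z j} :=
        measure_iUnion_fintype_le _ _
    _ ≤ ∑ _j : Fin d, ENNReal.ofReal (δ / d) := by
        refine Finset.sum_le_sum fun j _ => ?_
        refine measure_exceed_le_of_scalarMultiplier_le
          (b := (beta P k lam f ε x (δ / d)).toNNReal) (fun z => Real.sqrt_nonneg _) ?_
        rw [ENNReal.coe_toNNReal hβ]
        exact le_iSup (fun j : Fin d => scalarMultiplier P (fun z ω => f z ω j)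
          (fun z ω => postMean k lam f ε x z ω j) (fun z => postStd k lam x z j) (δ / d)) j
    _ = ENNReal.ofReal δ := by
        rw [← ENNReal.ofReal_sum_of_nonneg fun _ _ => by positivity]
        congr 1
        rw [Finset.sum_const, Finset.card_univ, nsmul_eq_mul, Fintype.card_fin]
        field_simp

end MultiGP

theorem theorem1 {Ω Z : Type*} [MeasurableSpace Ω] (P : Measure Ω) [IsProbabilityMeasure P]
    {d n : ℕ} (hd : 0 < d)
    (k : Z → Z → Matrix (Fin d) (Fin d) ℝ) (f : Z → Ω → EuclideanSpace ℝ (Fin d))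
    (hf : MultiGP.IsMultiOutputGP P f k)
    (lam : ℝ) (hlam : 0 < lam) (ε : Fin n → Ω → EuclideanSpace ℝ (Fin d))
    (hε : MultiGP.IsGaussianNoise P f lam ε) (x : Fin n → Z) :
    (∀ (S : Set (EuclideanSpace ℝ (Fin d))) (_ : Convex ℝ S)
        (_ : ∀ z ω, f z ω ∈ S) (_ : ∀ z ω, MultiGP.postMean k lam f ε x z ω ∈ S)
        (v : EuclideanSpace ℝ (Fin d) → ℝ) (u_G u_H : ℝ)
        (_ : ∀ s ∈ S, MultiGP.TwiceDifferentiableAt v s)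
        (_ : ∀ s ∈ S, ‖gradient v s‖ ≤ u_G)
        (_ : ∀ s ∈ S, ‖fderiv ℝ (gradient v) s‖ ≤ u_H)
        (δ : ℝ) (_ : 0 < δ) (_ : δ < 1)
        (_ : MultiGP.beta P k lam f ε x (δ / d) ≠ ⊤),
      P {ω | ¬ ∀ z, |v (f z ω) - v (MultiGP.postMean k lam f ε x z ω)| ≤
          u_G * (MultiGP.beta P k lam f ε x (δ / d)).toReal * ‖MultiGP.postStd k lam x z‖ +
          1 / 2 * u_H * (MultiGP.beta P k lam f ε x (δ / d)).toReal ^ 2 *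
            ‖MultiGP.postStd k lam x z‖ ^ 2} ≤ ENNReal.ofReal δ) ∧
    (∀ (_ : Finite Z) (δ : ℝ) (_ : 0 < δ) (_ : δ < 1),
      MultiGP.beta P k lam f ε x δ ≤
        ENNReal.ofReal √(2 * Real.log (2 * Nat.card Z / δ))) := by
  refine ⟨?_, fun hZ δ hδ hδ1 => MultiGP.beta_le_of_finite hf hε hlam x hδ hδ1⟩
  intro S hS hfS hmS v u_G u_H hv hG hH δ hδ _ hβ
  refine (measure_mono fun ω hω => ?_).trans (MultiGP.measure_exists_coord_exceed_le hd hδ hβ)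
  by_contra hcon
  simp only [Set.mem_iUnion, Set.mem_ofPred_eq, not_exists, not_not] at hcon
  refine hω fun z => ?_
  have hnorm : ‖f z ω - MultiGP.postMean k lam f ε x z ω‖ ≤
      (MultiGP.beta P k lam f ε x (δ / d)).toReal * ‖MultiGP.postStd k lam x z‖ :=
    MultiGP.norm_le_mul_norm_of_abs_le ENNReal.toReal_nonneg fun j => hcon j z
  -- `S` contains `f z ω`, so the bounds `u_G` and `u_H` are nonnegative, as monotonicity in the
  -- norm requires.
  have hG0 : 0 ≤ u_G := (norm_nonneg _).trans (hG _ (hfS z ω))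
  have hH0 : 0 ≤ u_H := (norm_nonneg _).trans (hH _ (hfS z ω))
  refine (MultiGP.abs_sub_le_of_gradient_bounds hS hv hG hH (hmS z ω) (hfS z ω)).trans ?_
  rw [mul_assoc u_G, mul_assoc (1 / 2 * u_H), ← mul_pow]
  gcongr
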